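/- Let $n,t\in\mathbb N$ and let $G$ be a ring (associative, not necessarily commutative, not necessarily with a unit). A polynomial in $n$ variables over $G$ is a finite sum of terms $\pm w$, where $w$ is a nonempty finite product, in any order, of constants from $G$ and variables $x_1,\dots,x_n$ (the variables commute neither with each other nor with the constants). A map $P=(p_1,\dots,p_t)\colon G^n\to G^t$ is a polynomial mapping over $G$ if each $p_l\colon G^n\to G$ is given by a polynomial in $n$ variables over $G$. **Proposition 7.9.** Let $P\colon G^n\to G^t$ be a polynomial mapping over $G$ with $P(0)=0$, let $(g_j)_{j\in\mathbb N}$ be a sequence of elements of $G^n$, and let $F\subset G^n$ be a finite set. For every $r\in\mathbb N$ and every coloring $\chi\colon G^t\to\{1,\dots,r\}$ there are $h\in G^t$ and a nonempty finite set $\gamma\subset\mathbb N$ such that, with $(x_1,\dots,x_n)=\sum_{j\in\gamma}g_j\in G^n$, the set $$\{\,h+P(x_1v_1,\dots,x_nv_n) : (v_1,\dots,v_n)\in F\,\}$$ is monochromatic, i.e. $\chi$ is constant on it. -/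

import Mathlib

/-- `p : G^n → G` is the map of a polynomial in `n` variables over the (not necessarily commutative,
not necessarily unital) ring `G`: it is a finite sum of signed nonempty finite products, the factors of which
are constants from `G` and coordinate functions `x ↦ x i`, in any order. In other words, it lies in
the ring of functions generated by the constants and the coordinate functions. -/
def IsPolynomialFun {G : Type*} [NonUnitalRing G] {n : ℕ} (p : (Fin n → G) → G) : Prop :=
  p ∈ NonUnitalSubring.closure
    (Set.range (fun (c : G) (_ : Fin n → G) => c) ∪
      Set.range (fun (i : Fin n) (x : Fin n → G) => x i))

/-- `P : G^n → G^t` is a polynomial mapping over `G`: each of its `t` components is a polynomial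
in `n` variables over `G`. -/
def IsPolynomialMapping {G : Type*} [NonUnitalRing G] {n t : ℕ}
    (P : (Fin n → G) → (Fin t → G)) : Prop :=
  ∀ l : Fin t, IsPolynomialFun (fun x => P x l)

/-- The set `M` is monochromatic for the coloring `χ`: `χ` is constant on `M`. -/
def IsMonochromatic {W : Type*} {r : ℕ} (χ : W → Fin r) (M : Set W) : Prop :=
  ∃ c : Fin r, ∀ w ∈ M, χ w = c

/-! ### Polynomial maps between commutative groups, via iterated differences -/

section PolynomialMaps

/-! Only the additive structure matters: a polynomial over `G` is a map killed by finitely many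
differences, and so is `x ↦ P (x v)` for each `v`. The claim thus reduces to finite families of such
maps vanishing at `0`. For these the proof is a PET induction. Subtracting a member `p₁` of least
degree from all shifts `p (x + a) - p a` lowers the weight (`polyWeight_vdcFamily_lt`), and color
focusing carries regularity from the new family back to the old one (`exists_colorFocused`). -/

/-- The group of maps between additive commutative groups all of whose `k`-fold iterated
differences vanish, i.e. of polynomial maps of degree less than `k`. -/
def polyDegreeLT (Z H : Type*) [AddCommGroup Z] [AddCommGroup H] : ℕ → AddSubgroup (Z → H)
  | 0 => ⊥
  | k + 1 =>
    { carrier := {p | ∀ a, (fun x => p (x + a) - p x) ∈ polyDegreeLT Z H k}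
      zero_mem' := fun a => by
        convert (polyDegreeLT Z H k).zero_mem using 1
        ext x; simp
      add_mem' := fun {p q} hp hq a => by
        convert (polyDegreeLT Z H k).add_mem (hp a) (hq a) using 1
        ext x; simp only [Pi.add_apply]; abel
      neg_mem' := fun {p} hp a => by
        convert (polyDegreeLT Z H k).neg_mem (hp a) using 1
        ext x; simp only [Pi.neg_apply]; abel }

variable {Z H : Type*} [AddCommGroup Z] [AddCommGroup H]

theorem mem_polyDegreeLT_zero {p : Z → H} : p ∈ polyDegreeLT Z H 0 ↔ p = 0 := by
  simp [polyDegreeLT]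

theorem mem_polyDegreeLT_succ {k : ℕ} {p : Z → H} :
    p ∈ polyDegreeLT Z H (k + 1) ↔ ∀ a, (fun x => p (x + a) - p x) ∈ polyDegreeLT Z H k :=
  Iff.rfl

theorem polyDegreeLT_le_succ (k : ℕ) : polyDegreeLT Z H k ≤ polyDegreeLT Z H (k + 1) := by
  induction k with
  | zero =>
    intro p hp
    rw [mem_polyDegreeLT_zero] at hp
    subst hp
    exact zero_mem _
  | succ k ih => exact fun p hp a => ih (hp a)

theorem polyDegreeLT_mono : Monotone (polyDegreeLT Z H) :=
  monotone_nat_of_le_succ polyDegreeLT_le_succ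

theorem const_mem_polyDegreeLT (k : ℕ) (c : H) :
    (fun _ : Z => c) ∈ polyDegreeLT Z H (k + 1) := by
  intro a
  simp only [sub_self]
  exact zero_mem _

theorem comp_addMonoidHom_mem_polyDegreeLT {Y : Type*} [AddCommGroup Y] (φ : Y →+ Z) {k : ℕ}
    {p : Z → H} (hp : p ∈ polyDegreeLT Z H k) : (fun y => p (φ y)) ∈ polyDegreeLT Y H k := by
  induction k generalizing p with
  | zero =>
    rw [mem_polyDegreeLT_zero] at hp ⊢
    subst hp
    rfl
  | succ k ih =>
    intro a
    simpa only [map_add] using ih (hp (φ a))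

theorem addMonoidHom_mem_polyDegreeLT (φ : Z →+ H) : (fun x => φ x) ∈ polyDegreeLT Z H 2 := by
  intro a
  simpa using const_mem_polyDegreeLT 0 (φ a)

theorem mem_polyDegreeLT_pi {ι : Type*} {k : ℕ} {p : Z → ι → H}
    (hp : ∀ i, (fun x => p x i) ∈ polyDegreeLT Z H k) : p ∈ polyDegreeLT Z (ι → H) k := by
  induction k generalizing p with
  | zero =>
    simp only [mem_polyDegreeLT_zero] at hp ⊢
    funext x i
    exact congrFun (hp i) x
  | succ k ih => exact fun a => ih fun i => hp i a

/-- Leibniz rule without commutativity: `Δ(pq) = Δp · q + p · Δq + Δp · Δq`. -/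
theorem mul_mem_polyDegreeLT {G : Type*} [NonUnitalRing G] {m k l : ℕ} (hm : k + l ≤ m)
    {p q : Z → G} (hp : p ∈ polyDegreeLT Z G k) (hq : q ∈ polyDegreeLT Z G l) :
    p * q ∈ polyDegreeLT Z G m := by
  induction m generalizing k l p q with
  | zero =>
    obtain rfl : k = 0 := by omega
    rw [mem_polyDegreeLT_zero] at hp
    simp [hp]
  | succ m ih =>
    rcases k with _ | k
    · rw [mem_polyDegreeLT_zero] at hp
      simp [hp]
    rcases l with _ | l
    · rw [mem_polyDegreeLT_zero] at hq
      simp [hq]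
    intro a
    have h₁ := ih (by omega) (hp a) hq
    have h₂ := ih (by omega) hp (hq a)
    have h₃ := ih (by omega) (hp a) (hq a)
    convert add_mem (add_mem h₁ h₂) h₃ using 1
    funext x
    simp only [Pi.mul_apply, Pi.add_apply, mul_sub, sub_mul]
    abel

theorem IsPolynomialFun.exists_mem_polyDegreeLT {G : Type*} [NonUnitalRing G] {n : ℕ}
    {p : (Fin n → G) → G} (hp : IsPolynomialFun p) :
    ∃ k, p ∈ polyDegreeLT (Fin n → G) G k := by
  refine NonUnitalSubring.closure_induction ?_ ?_ ?_ ?_ ?_ hp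
  · rintro _ (⟨c, rfl⟩ | ⟨i, rfl⟩)
    · exact ⟨1, const_mem_polyDegreeLT 0 c⟩
    · exact ⟨2, addMonoidHom_mem_polyDegreeLT (Pi.evalAddMonoidHom (fun _ : Fin n => G) i)⟩
  · exact ⟨0, zero_mem _⟩
  · rintro p q - - ⟨k, hk⟩ ⟨l, hl⟩
    exact ⟨max k l, add_mem (polyDegreeLT_mono (le_max_left k l) hk)
      (polyDegreeLT_mono (le_max_right k l) hl)⟩
  · rintro p - ⟨k, hk⟩
    exact ⟨k, neg_mem hk⟩
  · rintro p q - - ⟨k, hk⟩ ⟨l, hl⟩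
    exact ⟨k + l, mul_mem_polyDegreeLT le_rfl hk hl⟩

theorem IsPolynomialMapping.exists_mem_polyDegreeLT {G : Type*} [NonUnitalRing G] {n t : ℕ}
    {P : (Fin n → G) → (Fin t → G)} (hP : IsPolynomialMapping P) :
    ∃ k, P ∈ polyDegreeLT (Fin n → G) (Fin t → G) k := by
  choose k hk using fun l => (hP l).exists_mem_polyDegreeLT
  exact ⟨Finset.univ.sup k, mem_polyDegreeLT_pi fun l =>
    polyDegreeLT_mono (Finset.le_sup (Finset.mem_univ l)) (hk l)⟩

variable (Z H) in
/-- Polynomial maps of degree at most `k` that vanish at `0`. -/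
def polyZeroDegreeLE (k : ℕ) : AddSubgroup (Z → H) :=
  polyDegreeLT Z H (k + 1) ⊓ (Pi.evalAddMonoidHom (fun _ : Z => H) 0).ker

theorem mem_polyZeroDegreeLE {k : ℕ} {p : Z → H} :
    p ∈ polyZeroDegreeLE Z H k ↔ p ∈ polyDegreeLT Z H (k + 1) ∧ p 0 = 0 :=
  Iff.rfl

theorem polyZeroDegreeLE_mono : Monotone (polyZeroDegreeLE Z H) := fun _ _ h _ hp =>
  ⟨polyDegreeLT_mono (Nat.succ_le_succ h) hp.1, hp.2⟩

theorem mem_polyZeroDegreeLE_zero {p : Z → H} : p ∈ polyZeroDegreeLE Z H 0 ↔ p = 0 := by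
  refine ⟨fun ⟨h, h0⟩ => ?_, fun h => h ▸ zero_mem _⟩
  funext x
  have := congrFun (mem_polyDegreeLT_zero.1 (h x)) 0
  have h0 : p 0 = 0 := h0
  simpa [h0] using this

theorem shift_sub_mem_polyZeroDegreeLE {k : ℕ} {p : Z → H}
    (hp : p ∈ polyZeroDegreeLE Z H (k + 1)) (a : Z) :
    (fun x => p (x + a) - p a - p x) ∈ polyZeroDegreeLE Z H k := by
  have h0 : p 0 = 0 := hp.2
  refine mem_polyZeroDegreeLE.2 ⟨?_, by simp [h0]⟩
  convert sub_mem (hp.1 a) (const_mem_polyDegreeLT k (p a)) using 1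
  funext x
  simp only [Pi.sub_apply]
  abel

end PolynomialMaps

/-! ### Color focusing -/

section ColorFocusing

variable {Z H : Type*} [AddCommGroup Z] [AddCommGroup H]

/-- The family `A` of maps `Z → H` is partition regular along the finite sums of `g`, in a finitary
form: for any number of colors and any starting index there is a finite window in which every
coloring has a monochromatic configuration `{h} ∪ {h + p (∑ j ∈ γ, g j) : p ∈ A}`. -/
def IsIPPartitionRegular (g : ℕ → Z) (A : Set (Z → H)) : Prop :=
  ∀ r M : ℕ, ∃ (N : ℕ) (Q : Set H), Q.Finite ∧ ∀ χ : H → Fin r, ∃ h ∈ Q,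
    ∃ γ : Finset ℕ, γ.Nonempty ∧ γ ⊆ Finset.Ico M N ∧
      ∀ p ∈ A, χ (h + p (∑ j ∈ γ, g j)) = χ h

/-- The family obtained from `A` by shifting by elements of `S` and subtracting `p₁`. -/
def vdcFamily (A : Set (Z → H)) (p₁ : Z → H) (S : Set Z) : Set (Z → H) :=
  Set.image2 (fun p a x => p (x + a) - p a - p₁ x) A S

/-- Color `y` by the whole pattern `q ↦ χ (y + q)` on `T`; finiteness of `T` keeps the number of
colors finite. -/
theorem IsIPPartitionRegular.exists_pi {g : ℕ → Z} {A : Set (Z → H)}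
    (hA : IsIPPartitionRegular g A) {T : Set H} (hT : T.Finite) (r M : ℕ) :
    ∃ (N : ℕ) (Q : Set H), Q.Finite ∧ ∀ χ : H → Fin r, ∃ h ∈ Q,
      ∃ γ : Finset ℕ, γ.Nonempty ∧ γ ⊆ Finset.Ico M N ∧
        ∀ p ∈ A, ∀ q ∈ T, χ (h + p (∑ j ∈ γ, g j) + q) = χ (h + q) := by
  classical
  have := hT.fintype
  obtain ⟨N, Q, hQ, h⟩ := hA (Fintype.card (T → Fin r)) M
  refine ⟨N, Q, hQ, fun χ => ?_⟩
  obtain ⟨y, hy, γ, hγ, hγN, hc⟩ := h fun y => Fintype.equivFin _ fun q : T => χ (y + q)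
  exact ⟨y, hy, γ, hγ, hγN, fun p hp q hq =>
    congrFun ((Fintype.equivFin _).injective (hc p hp)) ⟨q, hq⟩⟩

/-- Either a monochromatic configuration occurs, or there are `s` of them of distinct colors, all
focused at a common point of yet another color. -/
theorem exists_colorFocused {g : ℕ → Z} {A : Set (Z → H)} (hAfin : A.Finite)
    (hA0 : ∀ p ∈ A, p 0 = 0) (p₁ : Z → H) (hp₁ : p₁ 0 = 0)
    (hA : ∀ S : Set Z, S.Finite → IsIPPartitionRegular g (vdcFamily A p₁ S)) (r M s : ℕ) :
    ∃ (N : ℕ) (Q : Set H), M ≤ N ∧ Q.Finite ∧ ∀ χ : H → Fin r, ∃ h ∈ Q,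
      (∃ γ : Finset ℕ, γ.Nonempty ∧ γ ⊆ Finset.Ico M N ∧
        ∀ p ∈ A, χ (h + p (∑ j ∈ γ, g j)) = χ h) ∨
      ∃ K : Finset (Fin r), K.card = s ∧ χ h ∉ K ∧
        ∀ c ∈ K, ∃ γ : Finset ℕ, γ.Nonempty ∧ γ ⊆ Finset.Ico M N ∧
          ∀ p ∈ A, χ (h + p (∑ j ∈ γ, g j)) = c := by
  classical
  induction s with
  | zero => exact ⟨M, {0}, le_rfl, Set.finite_singleton 0, fun χ => ⟨0, rfl, Or.inr ⟨∅, by simp⟩⟩⟩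
  | succ s ih =>
    obtain ⟨N, Q, hMN, hQ, hfoc⟩ := ih
    let S : Set Z := (fun γ : Finset ℕ => ∑ j ∈ γ, g j) '' ↑(Finset.Ico M N).powerset
    have hS : S.Finite := (Finset.finite_toSet _).image _
    have hS0 : (0 : Z) ∈ S := ⟨∅, by simp, by simp⟩
    -- All old foci `h` and all points `h + p b`, `b` a sum over the old window: their translates
    -- must keep their colors.
    let T : Set H := Q ∪ Set.image2 (· + ·) Q (Set.image2 (fun p a => p a) A S)
    have hT : T.Finite := hQ.union (hQ.image2 _ (hAfin.image2 _ hS))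
    obtain ⟨N', Q', hQ', hreg⟩ := (hA S hS).exists_pi hT r N
    let S' : Set Z := (fun γ : Finset ℕ => ∑ j ∈ γ, g j) '' ↑(Finset.Ico N N').powerset
    have hS' : S'.Finite := (Finset.finite_toSet _).image _
    -- The new focus is `y + h - p₁ x`; `x = 0` covers the case where a monochromatic configuration
    -- already occurred.
    refine ⟨max N N', Set.image2 (fun y x => y - p₁ x) (Set.image2 (· + ·) Q' Q) S',
      hMN.trans (le_max_left _ _), (hQ'.image2 _ hQ).image2 _ hS', fun χ => ?_⟩
    have hsub : Finset.Ico M N ⊆ Finset.Ico M (max N N') :=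
      Finset.Ico_subset_Ico le_rfl (le_max_left _ _)
    have hsub' : Finset.Ico N N' ⊆ Finset.Ico M (max N N') :=
      Finset.Ico_subset_Ico hMN (le_max_right _ _)
    obtain ⟨y, hy, γ, hγ, hγN, hc⟩ := hreg χ
    obtain ⟨h, hh, hmono | ⟨K, hK, hhK, hKc⟩⟩ := hfoc fun q => χ (y + q)
    · obtain ⟨β, hβ, hβN, hβc⟩ := hmono
      refine ⟨y + h, ⟨y + h, ⟨y, hy, h, hh, rfl⟩, 0, ⟨∅, by simp, by simp⟩, by simp [hp₁]⟩,
        Or.inl ⟨β, hβ, hβN.trans hsub, fun p hp => ?_⟩⟩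
      rw [add_assoc]
      exact hβc p hp
    · set x := ∑ j ∈ γ, g j with hx
      have hnew : ∀ p ∈ A, χ (y + h - p₁ x + p x) = χ (y + h) := fun p hp => by
        have := hc _ ⟨p, hp, 0, hS0, rfl⟩ h (Or.inl hh)
        rw [← this]
        congr 1
        simp only [add_zero, hA0 p hp]
        abel
      have hfocus : ∀ c ∈ insert (χ (y + h)) K, ∃ β : Finset ℕ, β.Nonempty ∧
          β ⊆ Finset.Ico M (max N N') ∧
          ∀ p ∈ A, χ (y + h - p₁ x + p (∑ j ∈ β, g j)) = c := by
        intro c hcK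
        rcases Finset.mem_insert.1 hcK with rfl | hcK
        · exact ⟨γ, hγ, hγN.trans hsub', hnew⟩
        · obtain ⟨β, hβ, hβN, hβc⟩ := hKc c hcK
          -- With `b` the sum over `β`, the point `y + h - p₁ x + p (x + b)` is `y + (p (x + b) - p
          -- b - p₁ x) + (h + p b)`, so it has the color of `y + h + p b`.
          refine ⟨γ ∪ β, hγ.mono Finset.subset_union_left,
            Finset.union_subset (hγN.trans hsub') (hβN.trans hsub), fun p hp => ?_⟩
          have hdisj : Disjoint γ β :=
            (Finset.Ico_disjoint_Ico_consecutive M N N').symm.mono hγN hβN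
          have hβS : ∑ j ∈ β, g j ∈ S := ⟨β, Finset.mem_coe.2 (Finset.mem_powerset.2 hβN), rfl⟩
          rw [Finset.sum_union hdisj, ← hx, ← hβc p hp]
          have := hc _ ⟨p, hp, _, hβS, rfl⟩ (h + p (∑ j ∈ β, g j))
            (Or.inr ⟨h, hh, _, ⟨p, hp, _, hβS, rfl⟩, rfl⟩)
          rw [← this]
          congr 1
          dsimp only
          generalize p (x + ∑ j ∈ β, g j) = u
          abel
      refine ⟨y + h - p₁ x, ⟨y + h, ⟨y, hy, h, hh, rfl⟩, x,
        ⟨γ, Finset.mem_coe.2 (Finset.mem_powerset.2 hγN), rfl⟩, rfl⟩, ?_⟩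
      by_cases hmem : χ (y + h - p₁ x) ∈ insert (χ (y + h)) K
      · exact Or.inl (hfocus _ hmem)
      · exact Or.inr ⟨_, by rw [Finset.card_insert_of_notMem hhK, hK], hmem, hfocus⟩

theorem IsIPPartitionRegular.of_vdcFamily {g : ℕ → Z} {A : Set (Z → H)} (hAfin : A.Finite)
    (hA0 : ∀ p ∈ A, p 0 = 0) (p₁ : Z → H) (hp₁ : p₁ 0 = 0)
    (hA : ∀ S : Set Z, S.Finite → IsIPPartitionRegular g (vdcFamily A p₁ S)) :
    IsIPPartitionRegular g A := by
  intro r M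
  obtain ⟨N, Q, -, hQ, hfoc⟩ := exists_colorFocused hAfin hA0 p₁ hp₁ hA r M r
  refine ⟨N, Q, hQ, fun χ => ?_⟩
  obtain ⟨h, hh, hmono | ⟨K, hK, hhK, -⟩⟩ := hfoc χ
  · exact ⟨h, hh, hmono⟩
  -- With `r` colors used, none is left for the focus.
  · have : K = Finset.univ := Finset.eq_univ_of_card K (by simpa using hK)
    exact absurd (this ▸ Finset.mem_univ (χ h)) hhK

theorem IsIPPartitionRegular.of_diff_zero {g : ℕ → Z} {A : Set (Z → H)}
    (hA : IsIPPartitionRegular g (A \ {0})) : IsIPPartitionRegular g A := by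
  intro r M
  obtain ⟨N, Q, hQ, h⟩ := hA r M
  refine ⟨N, Q, hQ, fun χ => ?_⟩
  obtain ⟨y, hy, γ, hγ, hγN, hc⟩ := h χ
  refine ⟨y, hy, γ, hγ, hγN, fun p hp => ?_⟩
  by_cases hp0 : p = 0
  · simp [hp0]
  · exact hc p ⟨hp, hp0⟩

theorem isIPPartitionRegular_empty (g : ℕ → Z) :
    IsIPPartitionRegular g (∅ : Set (Z → H)) := fun _ M =>
  ⟨M + 1, {0}, Set.finite_singleton 0, fun _ => ⟨0, rfl, {M}, by simp⟩⟩

end ColorFocusing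

/-! ### Weights and PET induction -/

section WeightInduction

variable {Z H : Type*} [AddCommGroup Z] [AddCommGroup H]

/-- The classes, modulo maps of degree at most `k`, of the members of `A` of degree `k + 1`. -/
def leadingClasses (A : Set (Z → H)) (k : ℕ) : Set ((Z → H) ⧸ polyZeroDegreeLE Z H k) :=
  QuotientAddGroup.mk '' {p ∈ A | p ∈ polyZeroDegreeLE Z H (k + 1) ∧ p ∉ polyZeroDegreeLE Z H k}

/-- The weight of a family of polynomial maps: the numbers of leading classes of degrees
`D, D - 1, …, 1`, compared lexicographically. -/
noncomputable def polyWeight (D : ℕ) (A : Set (Z → H)) : Lex (Fin D → ℕ) :=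
  toLex fun i => (leadingClasses A (D - 1 - i)).ncard

theorem exists_degree {k : ℕ} {p : Z → H} (hp : p ∈ polyZeroDegreeLE Z H k) (hp0 : p ≠ 0) :
    ∃ d < k, p ∈ polyZeroDegreeLE Z H (d + 1) ∧ p ∉ polyZeroDegreeLE Z H d := by
  induction k with
  | zero => exact absurd (mem_polyZeroDegreeLE_zero.1 hp) hp0
  | succ k ih =>
    by_cases h : p ∈ polyZeroDegreeLE Z H k
    · obtain ⟨d, hd, h⟩ := ih h
      exact ⟨d, hd.trans k.lt_succ_self, h⟩
    · exact ⟨k, k.lt_succ_self, hp, h⟩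

theorem degree_unique {j k : ℕ} {p : Z → H} (hj : p ∈ polyZeroDegreeLE Z H (j + 1))
    (hj' : p ∉ polyZeroDegreeLE Z H j) (hk : p ∈ polyZeroDegreeLE Z H (k + 1))
    (hk' : p ∉ polyZeroDegreeLE Z H k) : j = k := by
  by_contra hne
  rcases Nat.lt_or_gt_of_ne hne with h | h
  · exact hk' (polyZeroDegreeLE_mono h hj)
  · exact hj' (polyZeroDegreeLE_mono h hk)

theorem shift_sub_sub_mem {k d : ℕ} (hdk : d ≤ k) {p p₁ : Z → H}
    (hp : p ∈ polyZeroDegreeLE Z H (k + 1)) (hp₁ : p₁ ∈ polyZeroDegreeLE Z H (d + 1)) (a : Z) :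
    (fun x => p (x + a) - p a - p₁ x) ∈ polyZeroDegreeLE Z H (k + 1) := by
  have h := polyZeroDegreeLE_mono k.le_succ (shift_sub_mem_polyZeroDegreeLE hp a)
  convert sub_mem (add_mem h hp) (polyZeroDegreeLE_mono (Nat.succ_le_succ hdk) hp₁) using 1
  funext x
  simp

theorem mk_shift_sub {k : ℕ} {p p₁ : Z → H} (hp : p ∈ polyZeroDegreeLE Z H (k + 1)) (a : Z) :
    ((fun x => p (x + a) - p a - p₁ x : Z → H) : (Z → H) ⧸ polyZeroDegreeLE Z H k) =
      ((p - p₁ : Z → H) : (Z → H) ⧸ polyZeroDegreeLE Z H k) := by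
  rw [eq_comm, QuotientAddGroup.eq]
  convert shift_sub_mem_polyZeroDegreeLE hp a using 1
  funext x
  simp only [Pi.add_apply, Pi.neg_apply, Pi.sub_apply]
  abel

theorem mk_sub_of_mem {k : ℕ} {p p₁ : Z → H} (hp₁ : p₁ ∈ polyZeroDegreeLE Z H k) :
    ((p - p₁ : Z → H) : (Z → H) ⧸ polyZeroDegreeLE Z H k) = p := by
  rw [QuotientAddGroup.eq]
  simpa using hp₁

theorem mem_iff_of_mk_eq {k : ℕ} {p q : Z → H}
    (h : (p : (Z → H) ⧸ polyZeroDegreeLE Z H k) = q) :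
    p ∈ polyZeroDegreeLE Z H k ↔ q ∈ polyZeroDegreeLE Z H k := by
  rw [← QuotientAddGroup.eq_zero_iff, ← QuotientAddGroup.eq_zero_iff, h]

variable {A : Set (Z → H)} {D d : ℕ} {p₁ : Z → H} {S : Set Z}

/-- Modulo degree at most `k`, neither shifting a map of degree `k + 1` nor subtracting `p₁`, of
degree at most `d + 1 ≤ k`, changes its class. -/
theorem leadingClasses_vdcFamily_of_lt (hAD : ∀ p ∈ A, p ∈ polyZeroDegreeLE Z H D)
    (hAd : ∀ p ∈ A, p ∉ polyZeroDegreeLE Z H d) (hp₁ : p₁ ∈ polyZeroDegreeLE Z H (d + 1))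
    (hS : (0 : Z) ∈ S) {k : ℕ} (hk : d < k) :
    leadingClasses (vdcFamily A p₁ S) k = leadingClasses A k := by
  have hp₁k : p₁ ∈ polyZeroDegreeLE Z H k := polyZeroDegreeLE_mono hk hp₁
  ext c
  constructor
  · rintro ⟨_, ⟨⟨p, hp, a, -, rfl⟩, hq, hq'⟩, rfl⟩
    obtain ⟨j, -, hj, hj'⟩ := exists_degree (hAD p hp) fun h => hAd p hp (h ▸ zero_mem _)
    have hdj : d ≤ j := by
      by_contra hlt
      exact hAd p hp (polyZeroDegreeLE_mono (not_le.1 hlt) hj)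
    have hqj := shift_sub_sub_mem hdj hj hp₁ a
    have hkj : k ≤ j := by
      by_contra hlt
      exact hq' (polyZeroDegreeLE_mono (not_le.1 hlt) hqj)
    have hclass := (mk_shift_sub hj a).trans
      (mk_sub_of_mem (p := p) (polyZeroDegreeLE_mono hkj hp₁k))
    obtain rfl : j = k := degree_unique hqj (fun h => hj' ((mem_iff_of_mk_eq hclass).1 h)) hq hq'
    exact ⟨p, ⟨hp, hj, hj'⟩, hclass.symm⟩
  · rintro ⟨p, ⟨hp, hpk, hpk'⟩, rfl⟩
    have hclass := (mk_shift_sub hpk 0).trans (mk_sub_of_mem (p := p) hp₁k)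
    exact ⟨_, ⟨⟨p, hp, 0, hS, rfl⟩, shift_sub_sub_mem hk.le hpk hp₁ 0,
      fun h => hpk' ((mem_iff_of_mk_eq hclass).1 h)⟩, hclass⟩

/-- In degree `d + 1` all classes are translated by that of `p₁`, whose own class becomes zero and
is lost. -/
theorem ncard_leadingClasses_vdcFamily_lt (hAfin : A.Finite)
    (hAD : ∀ p ∈ A, p ∈ polyZeroDegreeLE Z H D)
    (hAd : ∀ p ∈ A, p ∉ polyZeroDegreeLE Z H d) (hp₁A : p₁ ∈ A)
    (hp₁ : p₁ ∈ polyZeroDegreeLE Z H (d + 1)) :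
    (leadingClasses (vdcFamily A p₁ S) d).ncard < (leadingClasses A d).ncard := by
  have hfin : (leadingClasses A d).Finite := (hAfin.subset (Set.sep_subset _ _)).image _
  have hmem : (p₁ : (Z → H) ⧸ polyZeroDegreeLE Z H d) ∈ leadingClasses A d :=
    ⟨p₁, ⟨hp₁A, hp₁, hAd p₁ hp₁A⟩, rfl⟩
  have hsub : leadingClasses (vdcFamily A p₁ S) d ⊆
      (fun c => c - (p₁ : (Z → H) ⧸ polyZeroDegreeLE Z H d)) ''
        (leadingClasses A d \ {(p₁ : (Z → H) ⧸ polyZeroDegreeLE Z H d)}) := by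
    rintro _ ⟨_, ⟨⟨p, hp, a, -, rfl⟩, hq, hq'⟩, rfl⟩
    obtain ⟨j, -, hj, hj'⟩ := exists_degree (hAD p hp) fun h => hAd p hp (h ▸ zero_mem _)
    have hdj : d ≤ j := by
      by_contra hlt
      exact hAd p hp (polyZeroDegreeLE_mono (not_le.1 hlt) hj)
    obtain rfl : d = j := by
      by_contra hne
      have hlt : d < j := lt_of_le_of_ne hdj hne
      have hclass := (mk_shift_sub hj a).trans
        (mk_sub_of_mem (p := p) (polyZeroDegreeLE_mono hlt hp₁))
      exact hj' ((mem_iff_of_mk_eq hclass).1 (polyZeroDegreeLE_mono hlt hq))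
    have hclass := mk_shift_sub (p₁ := p₁) hj a
    refine ⟨p, ⟨⟨p, ⟨hp, hj, hj'⟩, rfl⟩, fun h => hq' ?_⟩, hclass.symm⟩
    rw [← QuotientAddGroup.eq_zero_iff, hclass, QuotientAddGroup.mk_sub, sub_eq_zero]
    exact h
  calc _ ≤ _ := Set.ncard_le_ncard hsub (hfin.sdiff.image _)
    _ ≤ _ := Set.ncard_image_le hfin.sdiff
    _ < _ := Set.ncard_sdiff_singleton_lt_of_mem hmem hfin

theorem polyWeight_vdcFamily_lt (hAfin : A.Finite) (hAD : ∀ p ∈ A, p ∈ polyZeroDegreeLE Z H D)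
    (hAd : ∀ p ∈ A, p ∉ polyZeroDegreeLE Z H d) (hdD : d < D) (hp₁A : p₁ ∈ A)
    (hp₁ : p₁ ∈ polyZeroDegreeLE Z H (d + 1)) (hS : (0 : Z) ∈ S) :
    polyWeight D (vdcFamily A p₁ S) < polyWeight D A := by
  refine ⟨⟨D - 1 - d, by omega⟩, fun i hi => ?_, ?_⟩
  · have hi : (i : ℕ) < D - 1 - d := hi
    exact congrArg Set.ncard (leadingClasses_vdcFamily_of_lt hAD hAd hp₁ hS (by omega))
  · have h : D - 1 - (D - 1 - d) = d := by omega
    change (leadingClasses _ (D - 1 - (D - 1 - d))).ncard <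
      (leadingClasses _ (D - 1 - (D - 1 - d))).ncard
    rw [h]
    exact ncard_leadingClasses_vdcFamily_lt hAfin hAD hAd hp₁A hp₁

theorem leadingClasses_diff_zero (A : Set (Z → H)) (k : ℕ) :
    leadingClasses (A \ {0}) k = leadingClasses A k := by
  unfold leadingClasses
  congr 1
  ext p
  refine ⟨fun h => ⟨h.1.1, h.2⟩, fun h => ⟨⟨h.1, ?_⟩, h.2⟩⟩
  rintro rfl
  exact h.2.2 (zero_mem _)

theorem IsIPPartitionRegular.mono {g : ℕ → Z} {A B : Set (Z → H)} (hAB : A ⊆ B)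
    (hB : IsIPPartitionRegular g B) : IsIPPartitionRegular g A := by
  intro r M
  obtain ⟨N, Q, hQ, h⟩ := hB r M
  refine ⟨N, Q, hQ, fun χ => ?_⟩
  obtain ⟨y, hy, γ, hγ, hγN, hc⟩ := h χ
  exact ⟨y, hy, γ, hγ, hγN, fun p hp => hc p (hAB hp)⟩

/-- The polynomial van der Waerden theorem along finite sums, for polynomial maps between
commutative groups. -/
theorem isIPPartitionRegular_of_polynomial (g : ℕ → Z) (D : ℕ) (A : Set (Z → H))
    (hAfin : A.Finite) (hAD : ∀ p ∈ A, p ∈ polyZeroDegreeLE Z H D) :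
    IsIPPartitionRegular g A := by
  induction hw : polyWeight D A using WellFoundedLT.induction generalizing A with
  | ind w ih =>
    subst hw
    refine IsIPPartitionRegular.of_diff_zero ?_
    have hw : polyWeight D (A \ {0}) = polyWeight D A := by
      simp only [polyWeight, leadingClasses_diff_zero]
    rw [← hw] at ih
    have hAfin' : (A \ {0}).Finite := hAfin.sdiff
    have hAD' : ∀ p ∈ A \ {0}, p ∈ polyZeroDegreeLE Z H D := fun p hp => hAD p hp.1
    have hne : ∀ p ∈ A \ {0}, p ≠ 0 := fun p hp => hp.2
    generalize A \ {0} = B at *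
    rcases B.eq_empty_or_nonempty with rfl | ⟨q, hq⟩
    · exact isIPPartitionRegular_empty g
    classical
    have hex : ∃ d, ∃ p ∈ B, p ∈ polyZeroDegreeLE Z H (d + 1) := by
      obtain ⟨d, -, hd, -⟩ := exists_degree (hAD' q hq) (hne q hq)
      exact ⟨d, q, hq, hd⟩
    obtain ⟨p₁, hp₁B, hp₁⟩ := Nat.find_spec hex
    have hBd : ∀ p ∈ B, p ∉ polyZeroDegreeLE Z H (Nat.find hex) := by
      intro p hp hpd
      obtain ⟨d, hd, hpd, -⟩ := exists_degree hpd (hne p hp)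
      exact Nat.find_min hex hd ⟨p, hp, hpd⟩
    have hdD : Nat.find hex < D := by
      by_contra hle
      exact hBd p₁ hp₁B (polyZeroDegreeLE_mono (not_lt.1 hle) (hAD' p₁ hp₁B))
    refine IsIPPartitionRegular.of_vdcFamily hAfin' (fun p hp => (hAD' p hp).2) p₁
      (hAD' p₁ hp₁B).2 fun S hS => ?_
    -- The shift `0` is added so that every class above the least degree survives and the weights
    -- compare.
    refine IsIPPartitionRegular.mono (Set.image2_subset_left (Set.subset_insert 0 S)) ?_
    refine ih _ (polyWeight_vdcFamily_lt hAfin' hAD' hBd hdD hp₁B hp₁ (Set.mem_insert 0 S)) _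
      (hAfin'.image2 _ (hS.insert 0)) ?_ rfl
    rintro _ ⟨p, hp, a, -, rfl⟩
    obtain ⟨k, rfl⟩ : ∃ k, D = k + 1 := Nat.exists_eq_succ_of_ne_zero (by omega)
    exact shift_sub_sub_mem (d := k) le_rfl (hAD' p hp) (hAD' p₁ hp₁B) a

end WeightInduction

theorem proposition7p9 {G : Type*} [NonUnitalRing G] {n t : ℕ}
    (P : (Fin n → G) → (Fin t → G)) (hP : IsPolynomialMapping P) (hP0 : P 0 = 0)
    (g : ℕ → (Fin n → G)) (F : Finset (Fin n → G))
    {r : ℕ} (χ : (Fin t → G) → Fin r) :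
    ∃ (h : Fin t → G) (γ : Finset ℕ), γ.Nonempty ∧
      IsMonochromatic χ
        {y | ∃ v ∈ F, y = h + P (fun i => (∑ j ∈ γ, g j) i * v i)} := by
  obtain ⟨k, hk⟩ := hP.exists_mem_polyDegreeLT
  let A : Set ((Fin n → G) → (Fin t → G)) :=
    (fun (v x : Fin n → G) => P (fun i => x i * v i)) '' (F : Set (Fin n → G))
  have hA : ∀ p ∈ A, p ∈ polyZeroDegreeLE (Fin n → G) (Fin t → G) k := by
    rintro _ ⟨v, -, rfl⟩
    refine mem_polyZeroDegreeLE.2 ⟨polyDegreeLT_le_succ k ?_, ?_⟩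
    · exact comp_addMonoidHom_mem_polyDegreeLT (AddMonoidHom.mulRight v) hk
    · simp only [Pi.zero_apply, zero_mul]
      exact hP0
  obtain ⟨N, Q, -, hreg⟩ :=
    isIPPartitionRegular_of_polynomial g k A (F.finite_toSet.image _) hA r 0
  obtain ⟨h, -, γ, hγ, -, hc⟩ := hreg χ
  refine ⟨h, γ, hγ, χ h, ?_⟩
  rintro _ ⟨v, hv, rfl⟩
  exact hc _ ⟨v, hv, rfl⟩
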